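/- Fix an algebraic language $\tau$ (finitary operation symbols, possibly including constant symbols). Algebras are nonempty, and a variety is a class of $\tau$-algebras closed under homomorphic images, subalgebras and direct products. An identity $s\approx t$ is called regular if exactly the same variables occur in $s$ and in $t$, and irregular otherwise. A variety is irregular if it satisfies at least one irregular identity; it is strongly irregular if it satisfies $f(x,y)\approx x$ for some term $f(x,y)$ in which exactly the two distinct variables $x$ and $y$ occur. The regularization $R(\mathcal V)$ of a variety $\mathcal V$ is the variety defined by all regular identities that hold in $\mathcal V$. Let $\mathbf L(\mathcal V)$ be the lattice of subvarieties of $\mathcal V$, ordered by inclusion. **Theorem.** Let $\mathcal V$ be a variety of $\tau$-algebras. 1. If $\mathcal V$ is irregular, then for every subvariety $\mathcal W$ of $\mathcal V$, $\mathcal W$ is covered by $R(\mathcal W)$ in $\mathbf L(R(\mathcal V))$; that is, $\mathcal W\subsetneq R(\mathcal W)$ and no subvariety of $R(\mathcal V)$ lies strictly between $\mathcal W$ and $R(\mathcal W)$. 2. If $\mathcal V$ is strongly irregular, then $\mathcal W\mapsto R(\mathcal W)$ is a lattice embedding (an injective map that preserves binary meets and joins) of $\mathbf L(\mathcal V)$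 into $\mathbf L(R(\mathcal V))$. -/

import Mathlib

open scoped FirstOrder

universe u v w

namespace UniversalAlgebra

open FirstOrder FirstOrder.Language

/-- An algebra in the language `L` (which is going to be an algebraic one: operation symbols of
finite arity, constants being those of arity `0`): a nonempty set with an interpretation of the
operation symbols. -/
structure Alg (L : FirstOrder.Language.{u, v}) where
  carrier : Type w
  [str : L.Structure carrier]
  [nonempty : Nonempty carrier]

attribute [instance] Alg.str Alg.nonempty

/-- The direct product of structures: operations are computed coordinatewise. -/
instance piStructure (L : FirstOrder.Language.{u, v}) {ι : Type*} (A : ι → Type*)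
    [∀ i, L.Structure (A i)] : L.Structure (∀ i, A i) where
  funMap f x := fun i => Structure.funMap f (fun k => x k i)
  RelMap r x := ∀ i, Structure.RelMap r (fun k => x k i)

namespace Alg

variable {L : FirstOrder.Language.{u, v}}

/-- The direct product of a family of algebras (the one-element algebra if the family is empty). -/
def pi {ι : Type w} (A : ι → Alg.{u, v, w} L) : Alg.{u, v, w} L where
  carrier := ∀ i, (A i).carrier

/-- A nonempty subuniverse, as an algebra. -/
def sub (A : Alg.{u, v, w} L) (S : L.Substructure A.carrier) (hS : Nonempty S) :
    Alg.{u, v, w} L where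
  carrier := S

/-- The identity `s ≈ t` holds in `A`. Identities are pairs of terms over the countably infinite
set of variables `ℕ`. -/
def Satisfies (A : Alg.{u, v, w} L) (s t : L.Term ℕ) : Prop :=
  ∀ e : ℕ → A.carrier, s.realize e = t.realize e

end Alg

/-- A variety: a class of algebras closed under homomorphic images, subalgebras and direct
products. -/
@[ext]
structure Variety (L : FirstOrder.Language.{u, v}) where
  Mem : Alg.{u, v, w} L → Prop
  image_mem : ∀ (A B : Alg.{u, v, w} L) (f : A.carrier →[L] B.carrier),
    Function.Surjective f → Mem A → Mem B
  sub_mem : ∀ (A : Alg.{u, v, w} L) (S : L.Substructure A.carrier) (hS : Nonempty S),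
    Mem A → Mem (A.sub S hS)
  pi_mem : ∀ (ι : Type w) (A : ι → Alg.{u, v, w} L), (∀ i, Mem (A i)) → Mem (Alg.pi A)

/-- The identity `s ≈ t` is regular: the same variables occur in `s` and in `t`. -/
def RegularIdentity {L : FirstOrder.Language.{u, v}} (s t : L.Term ℕ) : Prop :=
  s.varFinset = t.varFinset

namespace Variety

variable {L : FirstOrder.Language.{u, v}}

/-- Varieties are ordered by inclusion of classes. -/
instance : PartialOrder (Variety.{u, v, w} L) where
  le V W := ∀ A, V.Mem A → W.Mem A
  le_refl _ _ h := h
  le_trans _ _ _ h₁ h₂ A h := h₂ A (h₁ A h)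
  le_antisymm V W h₁ h₂ := Variety.ext (funext fun A => propext ⟨h₁ A, h₂ A⟩)

/-- The intersection of two varieties. -/
def inter (V W : Variety.{u, v, w} L) : Variety.{u, v, w} L where
  Mem A := V.Mem A ∧ W.Mem A
  image_mem A B f hf h := ⟨V.image_mem A B f hf h.1, W.image_mem A B f hf h.2⟩
  sub_mem A S hS h := ⟨V.sub_mem A S hS h.1, W.sub_mem A S hS h.2⟩
  pi_mem ι A h := ⟨V.pi_mem ι A fun i => (h i).1, W.pi_mem ι A fun i => (h i).2⟩

/-- The smallest variety that contains two given varieties. -/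
def join (V W : Variety.{u, v, w} L) : Variety.{u, v, w} L where
  Mem A := ∀ U : Variety.{u, v, w} L, V ≤ U → W ≤ U → U.Mem A
  image_mem A B f hf h U hV hW := U.image_mem A B f hf (h U hV hW)
  sub_mem A S hS h U hV hW := U.sub_mem A S hS (h U hV hW)
  pi_mem ι A h U hV hW := U.pi_mem ι A fun i => h i U hV hW

/-- The lattice of all varieties. The lattice of subvarieties of `V` is its principal ideal
`Set.Iic V`. -/
instance : Lattice (Variety.{u, v, w} L) where
  inf := inter
  inf_le_left _ _ _ h := h.1
  inf_le_right _ _ _ h := h.2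
  le_inf _ _ _ h₁ h₂ A h := ⟨h₁ A h, h₂ A h⟩
  sup := join
  le_sup_left _ _ A h _ hV _ := hV A h
  le_sup_right _ _ A h _ _ hW := hW A h
  sup_le _ _ U h₁ h₂ _ h := h U h₁ h₂

/-- The identity `s ≈ t` holds in all members of `V`. -/
def Satisfies (V : Variety.{u, v, w} L) (s t : L.Term ℕ) : Prop :=
  ∀ A, V.Mem A → A.Satisfies s t

/-- `V` satisfies regular identities only. -/
def IsRegular (V : Variety.{u, v, w} L) : Prop :=
  ∀ s t : L.Term ℕ, V.Satisfies s t → RegularIdentity s t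

/-- `V` satisfies some irregular identity. -/
def IsIrregular (V : Variety.{u, v, w} L) : Prop := ¬ V.IsRegular

/-- There is a term `f(x, y)`, in which exactly the two distinct variables `x` and `y` occur, such
that `V` satisfies `f(x, y) ≈ x`. -/
def IsStronglyIrregular (V : Variety.{u, v, w} L) : Prop :=
  ∃ f : L.Term ℕ, f.varFinset = {0, 1} ∧ V.Satisfies f (Term.var 0)

/-- The class of all algebras that satisfy the identities in `E`. -/
def ofIdentities (E : L.Term ℕ → L.Term ℕ → Prop) : Variety.{u, v, w} L where
  Mem A := ∀ s t, E s t → A.Satisfies s t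
  image_mem A B f hf h s t hst e := by
    choose g hg using hf
    have he : e = f ∘ (g ∘ e) := by
      funext n
      simp [hg]
    rw [he, HomClass.realize_term, HomClass.realize_term, h s t hst]
  sub_mem A S hS h s t hst e := by
    have key : ∀ r : L.Term ℕ,
        (r.realize (M := (A.sub S hS).carrier) e).1 = r.realize fun n => (e n).1 := by
      intro r
      induction r with
      | var n => rfl
      | func f ts ih => exact congrArg (Structure.funMap f) (funext ih)
    exact Subtype.ext ((key s).trans ((h s t hst fun n => (e n).1).trans (key t).symm))
  pi_mem ι A h s t hst e := by
    have key : ∀ (r : L.Term ℕ) (i : ι),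
        r.realize (M := (Alg.pi A).carrier) e i = r.realize fun n => e n i := by
      intro r i
      induction r with
      | var n => rfl
      | func f ts ih => exact congrArg (Structure.funMap f) (funext ih)
    funext i
    exact (key s i).trans ((h i s t hst fun n => e n i).trans (key t i).symm)

/-- The regularization `R(V)`: the variety defined by the regular identities that hold in `V`. -/
def regularization (V : Variety.{u, v, w} L) : Variety.{u, v, w} L :=
  ofIdentities fun s t => RegularIdentity s t ∧ V.Satisfies s t

theorem le_regularization (V : Variety.{u, v, w} L) : V ≤ V.regularization :=
  fun A hA _ _ hst => hst.2 A hA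

theorem regularization_mono {V W : Variety.{u, v, w} L} (h : W ≤ V) :
    W.regularization ≤ V.regularization :=
  fun _ hA s t hst => hA s t ⟨hst.1, fun B hB => hst.2 B (h B hB)⟩

/-- A subvariety `W` of `V`, seen as a subvariety of `R(V)`. -/
def subIncl (V : Variety.{u, v, w} L) (W : Set.Iic V) : Set.Iic V.regularization :=
  ⟨W.1, le_trans W.2 V.le_regularization⟩

/-- The map `W ↦ R(W)` from subvarieties of `V` to subvarieties of `R(V)`. -/
def subReg (V : Variety.{u, v, w} L) (W : Set.Iic V) : Set.Iic V.regularization :=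
  ⟨W.1.regularization, regularization_mono W.2⟩

end Variety

end UniversalAlgebra

namespace UniversalAlgebra

open FirstOrder FirstOrder.Language

/-! ### Dependence of term values on variables -/

section Terms

variable {L : FirstOrder.Language.{u, v}}

/-! By Birkhoff's theorem, inclusions of varieties can be checked on identities. The two-element
semilattice satisfies exactly the regular identities, so it lies in every R(W), and R(W) satisfies
no others.

Covering: let W ≤ U ≤ R(W). If U is regular, its identities are regular identities of W, so U =
R(W). If U is irregular, some term u ignores in U a variable y that occurs in it. Placing a variable
at y makes it occur without affecting the value, and this turns enough identities of W into regular
ones to show that a term independent of z in W is independent of z in U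
(`realize_update_of_irregular`). For s ≈ t in W, each side then ignores in U the variables missing
from the other side; a substitution for these makes the identity regular, hence true in U. So U = W.
The same argument gives R(W) ⊓ V = W for W ≤ V, whence injectivity.

Joins are preserved because the identities of a join are the common ones. For meets, write a·b =
f(a,b). An algebra A in R(W₁) ⊓ R(W₂) splits into Płonka fibres, each lying in both W₁ and W₂
(`fibre_mem`). A regular identity at a point of A is tested in the fibre of the value of one side,
where it holds (`regularization_inf_le`). -/

theorem realize_congr {α M : Type*} [DecidableEq α] [L.Structure M] (t : L.Term α) {e e' : α → M}
    (h : ∀ i ∈ t.varFinset, e i = e' i) : t.realize e = t.realize e' := by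
  induction t with
  | var n => exact h n (by simp [Term.varFinset])
  | func f ts ih =>
    refine congrArg (Structure.funMap f) (funext fun k => ih k fun i hi => h i ?_)
    simp only [Term.varFinset, Finset.mem_biUnion, Finset.mem_univ, true_and]
    exact ⟨k, hi⟩

theorem mem_varFinset_func {n i : ℕ} (f : L.Functions n) (ts : Fin n → L.Term ℕ) :
    i ∈ (Term.func f ts).varFinset ↔ ∃ k, i ∈ (ts k).varFinset := by
  simp [Term.varFinset]

theorem mem_varFinset_subst (t : L.Term ℕ) (σ : ℕ → L.Term ℕ) (i : ℕ) :
    i ∈ (t.subst σ).varFinset ↔ ∃ j ∈ t.varFinset, i ∈ (σ j).varFinset := by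
  induction t with
  | var n => simp [Term.varFinset, Term.subst]
  | func f ts ih =>
    simp only [Term.subst, mem_varFinset_func, ih]
    constructor
    · rintro ⟨k, j, h, h'⟩
      exact ⟨j, ⟨k, h⟩, h'⟩
    · rintro ⟨j, ⟨k, h⟩, h'⟩
      exact ⟨k, j, h, h'⟩

/-- The realization of a term that is insensitive to changing the value of any single variable
outside `S` depends on the values of the variables in `S` only. -/
theorem realize_eq_of_update {M : Type*} [L.Structure M] (t : L.Term ℕ) (S : Set ℕ)
    (h : ∀ z ∉ S, ∀ (e : ℕ → M) (a : M), t.realize (Function.update e z a) = t.realize e)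
    {e e' : ℕ → M} (he : ∀ i ∈ S, e i = e' i) : t.realize e = t.realize e' := by
  classical
  have key : ∀ X : Finset ℕ, t.realize (fun i => if i ∈ X then e' i else e i) = t.realize e := by
    intro X
    induction X using Finset.induction_on with
    | empty => simp
    | insert z X hz ih =>
      rw [← ih]
      by_cases hzS : z ∈ S
      · congr 1
        funext i
        by_cases hi : i = z
        · subst hi
          simp [he i hzS]
        · simp [hi]
      · rw [← h z hzS (fun i => if i ∈ X then e' i else e i) (e' z)]
        congr 1
        funext i
        by_cases hi : i = z
        · subst hi
          simp
        · simp [hi]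
  rw [← key t.varFinset]
  exact realize_congr t fun i hi => by simp [hi]

end Terms

/-! ### Birkhoff's theorem -/

namespace Variety

variable {L : FirstOrder.Language.{u, v}}

/-- Identities over an arbitrary set of variables reduce to identities over `ℕ`. -/
theorem realize_eq_of_identities {α M : Type*} [L.Structure M] [Nonempty M]
    (V : Variety.{u, v, w} L) (hM : ∀ s t : L.Term ℕ, V.Satisfies s t →
      ∀ e : ℕ → M, s.realize e = t.realize e) (s t : L.Term α)
    (hst : ∀ B : Alg L, V.Mem B → ∀ φ : α → B.carrier, s.realize φ = t.realize φ) (e : α → M) :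
    s.realize e = t.realize e := by
  classical
  set X := s.varFinset ∪ t.varFinset
  obtain ⟨g, hg⟩ : ∃ g : α → ℕ, Set.InjOn g X := by
    refine ⟨fun a => if h : a ∈ X then (X.equivFin ⟨a, h⟩ : ℕ) else 0, fun a ha b hb hab => ?_⟩
    have ha' : a ∈ X := ha
    have hb' : b ∈ X := hb
    simp only [ha', hb', dif_pos] at hab
    simpa using X.equivFin.injective (Fin.ext hab)
  have hV : V.Satisfies (s.relabel g) (t.relabel g) := by
    intro B hB φ
    rw [Term.realize_relabel, Term.realize_relabel]
    exact hst B hB _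
  obtain ⟨d, hd⟩ : ∃ d : ℕ → M, ∀ a ∈ X, d (g a) = e a := by
    refine ⟨fun n => if h : ∃ a ∈ X, g a = n then e h.choose else Classical.arbitrary M,
      fun a ha => ?_⟩
    have h : ∃ b ∈ X, g b = g a := ⟨a, ha, rfl⟩
    simp only [dif_pos h]
    rw [hg h.choose_spec.1 ha h.choose_spec.2]
  have := hM _ _ hV d
  rw [Term.realize_relabel, Term.realize_relabel] at this
  exact (realize_congr s fun a ha => (hd a (Finset.mem_union_left _ ha)).symm).trans
    (this.trans (realize_congr t fun a ha => hd a (Finset.mem_union_right _ ha)))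

theorem realize_pi {ι : Type w} (A : ι → Alg.{u, v, w} L) {α : Type*} (t : L.Term α)
    (e : α → (Alg.pi A).carrier) (i : ι) : t.realize e i = t.realize fun n => e n i := by
  induction t with
  | var n => rfl
  | func f ts ih => exact congrArg (Structure.funMap f) (funext ih)

/-- Birkhoff's theorem: a variety contains all algebras that satisfy its identities. -/
theorem mem_of_satisfies [L.IsAlgebraic] (V : Variety.{u, v, max u w} L)
    (A : Alg.{u, v, max u w} L) (hA : ∀ s t, V.Satisfies s t → A.Satisfies s t) : V.Mem A := by
  classical
  -- Valuations into members of `V` form a proper class, but their kernels on terms form a set in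
  -- the right universe. One algebra per kernel suffices, and `ψ` then generates a free algebra `S`.
  let ι : Type (max u w) := {r : L.Term A.carrier → L.Term A.carrier → Prop //
    ∃ B : Alg.{u, v, max u w} L, V.Mem B ∧ ∃ φ : A.carrier → B.carrier,
      ∀ s t, r s t ↔ s.realize φ = t.realize φ}
  choose B hB φ hφ using fun r : ι => r.2
  let ψ : A.carrier → (Alg.pi B).carrier := fun a r => φ r a
  let S : L.Substructure (Alg.pi B).carrier :=
    { carrier := Set.range fun t : L.Term A.carrier => t.realize ψ
      fun_mem := by
        intro n f x hx
        choose ts hts using hx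
        refine ⟨Term.func f ts, ?_⟩
        exact congrArg (Structure.funMap f) (funext hts) }
  have hS : Nonempty S :=
    ⟨⟨ψ (Classical.arbitrary _), Term.var (Classical.arbitrary _), rfl⟩⟩
  have hVS : V.Mem ((Alg.pi B).sub S hS) := V.sub_mem _ S hS (V.pi_mem ι B hB)
  have wd : ∀ s t : L.Term A.carrier, s.realize ψ = t.realize ψ →
      s.realize (id : A.carrier → A.carrier) = t.realize id := by
    intro s t hst
    refine V.realize_eq_of_identities (fun s t h => hA s t h) s t (fun C hC χ => ?_) id
    let r : ι := ⟨fun s t => s.realize χ = t.realize χ, C, hC, χ, fun _ _ => Iff.rfl⟩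
    refine (hφ r s t).2 ?_
    have := congrFun hst r
    rwa [realize_pi, realize_pi] at this
  choose rep hrep using fun y : S => y.2
  let F : ((Alg.pi B).sub S hS).carrier → A.carrier := fun y => (rep y).realize id
  have hF : ∀ (y : S) (t : L.Term A.carrier), t.realize ψ = y.1 → F y = t.realize id :=
    fun y t ht => wd _ _ ((hrep y).trans ht.symm)
  refine V.image_mem _ A ⟨F, ?_, ?_⟩ ?_ hVS
  · intro n f x
    refine hF _ (Term.func f fun i => rep (x i)) ?_
    exact congrArg (Structure.funMap f) (funext fun i => hrep (x i))
  · intro n r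
    exact isEmptyElim r
  · intro a
    exact ⟨⟨ψ a, Term.var a, rfl⟩, hF _ (Term.var a) rfl⟩

theorem le_of_satisfies [L.IsAlgebraic] {V W : Variety.{u, v, max u w} L}
    (h : ∀ s t, W.Satisfies s t → V.Satisfies s t) : V ≤ W :=
  fun A hA => W.mem_of_satisfies A fun s t hst => h s t hst A hA

/-! ### Regular identities and the semilattice -/

/-- The two-element semilattice: every operation is the disjunction of its arguments. -/
def disjAlg (L : FirstOrder.Language.{u, v}) : Alg.{u, v, w} L :=
  letI : L.Structure (ULift.{w} Prop) :=
    { funMap := fun _ x => ⟨∃ i, (x i).down⟩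
      RelMap := fun _ _ => True }
  { carrier := ULift.{w} Prop }

theorem realize_disjAlg (t : L.Term ℕ) (e : ℕ → ULift.{w} Prop) :
    (t.realize (M := (disjAlg.{u, v, w} L).carrier) e : ULift.{w} Prop).down ↔
      ∃ i ∈ t.varFinset, (e i).down := by
  induction t with
  | var n =>
    simp only [Term.varFinset, Finset.mem_singleton, exists_eq_left]
    rfl
  | func f ts ih =>
    have h : (Term.realize (M := (disjAlg.{u, v, w} L).carrier) e (Term.func f ts) :
        ULift.{w} Prop).down ↔ ∃ k, ((ts k).realize (M := (disjAlg.{u, v, w} L).carrier) e :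
        ULift.{w} Prop).down := Iff.rfl
    rw [h]
    simp only [ih, mem_varFinset_func]
    constructor
    · rintro ⟨k, j, h, h'⟩
      exact ⟨j, ⟨k, h⟩, h'⟩
    · rintro ⟨j, ⟨k, h⟩, h'⟩
      exact ⟨k, j, h, h'⟩

theorem disjAlg_satisfies_iff (s t : L.Term ℕ) :
    (disjAlg.{u, v, w} L).Satisfies s t ↔ RegularIdentity s t := by
  constructor
  · intro h
    ext i
    -- Under this valuation a term is true exactly when `i` occurs in it.
    have := congrArg ULift.down (h (fun j => (⟨j = i⟩ : ULift.{w} Prop)))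
    have := Iff.of_eq this
    rw [realize_disjAlg, realize_disjAlg] at this
    simpa using this
  · intro h e
    refine ULift.ext _ _ (propext ((realize_disjAlg s e).trans ?_))
    rw [h]
    exact (realize_disjAlg t e).symm

theorem regularization_isRegular (W : Variety.{u, v, w} L) : W.regularization.IsRegular :=
  fun s t h => (disjAlg_satisfies_iff s t).1
    (h (disjAlg L) fun s t hst => (disjAlg_satisfies_iff s t).2 hst.1)

theorem regularization_satisfies_iff (W : Variety.{u, v, w} L) (s t : L.Term ℕ) :
    W.regularization.Satisfies s t ↔ RegularIdentity s t ∧ W.Satisfies s t :=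
  ⟨fun h => ⟨W.regularization_isRegular s t h, fun A hA => h A (W.le_regularization A hA)⟩,
    fun h _ hA => hA s t h⟩

/-! ### Irregular subvarieties of a regularization -/

/-- In an irregular variety some term `u` does not depend on the variable `y` occurring in it. -/
theorem IsIrregular.exists_term {U : Variety.{u, v, w} L} (h : U.IsIrregular) :
    ∃ (u : L.Term ℕ) (y : ℕ), y ∈ u.varFinset ∧ ∀ A, U.Mem A → ∀ (e : ℕ → A.carrier) (a : A.carrier),
      u.realize (Function.update e y a) = u.realize e := by
  have aux : ∀ (s t : L.Term ℕ) (y : ℕ), U.Satisfies s t → y ∉ t.varFinset →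
      ∀ A, U.Mem A → ∀ (e : ℕ → A.carrier) (a : A.carrier),
      s.realize (Function.update e y a) = s.realize e := by
    intro s t y hst hy A hA e a
    rw [hst A hA, hst A hA]
    refine realize_congr t fun i hi => Function.update_of_ne ?_ _ _
    rintro rfl
    exact hy hi
  simp only [IsIrregular, IsRegular, RegularIdentity, not_forall] at h
  obtain ⟨s, t, hst, hne⟩ := h
  by_cases hsub : s.varFinset ⊆ t.varFinset
  · obtain ⟨y, hy, hy'⟩ := Finset.not_subset.1 fun h' => hne (hsub.antisymm h')
    exact ⟨t, y, hy, aux t s y (fun A hA e => (hst A hA e).symm) hy'⟩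
  · obtain ⟨y, hy, hy'⟩ := Finset.not_subset.1 hsub
    exact ⟨s, y, hy, aux s t y hst hy'⟩

theorem IsIrregular.anti {U V : Variety.{u, v, w} L} (h : U ≤ V) (hV : V.IsIrregular) :
    U.IsIrregular :=
  fun hU => hV fun s t hst => hU s t fun A hA => hst A (h A hA)

/-- Let `U` be an irregular subvariety of `R(W)`. If `s` does not depend on the variable `z` in `W`,
neither does it in `U`. -/
theorem realize_update_of_irregular {U W : Variety.{u, v, w} L} (hU : U ≤ W.regularization)
    (hirr : U.IsIrregular) (s : L.Term ℕ) (z : ℕ)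
    (hs : ∀ A, W.Mem A → ∀ (e : ℕ → A.carrier) (a : A.carrier),
      s.realize (Function.update e z a) = s.realize e)
    (A : Alg.{u, v, w} L) (hA : U.Mem A) (e : ℕ → A.carrier) (a : A.carrier) :
    s.realize (Function.update e z a) = s.realize e := by
  classical
  obtain ⟨u, y, hy, hu⟩ := hirr.exists_term
  have reg : ∀ p q : L.Term ℕ, RegularIdentity p q → W.Satisfies p q → ∀ e : ℕ → A.carrier,
    p.realize e = q.realize e := fun p q h h' => hU A hA p q ⟨h, h'⟩
  by_cases hz : z ∈ s.varFinset
  swap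
  · refine realize_congr s fun i hi => Function.update_of_ne ?_ _ _
    rintro rfl
    exact hz hi
  /- `d p q` is the term `u(p, …, p, q)`, with `q` in the place of `y`. -/
  let d : L.Term ℕ → L.Term ℕ → L.Term ℕ := fun p q =>
    u.subst (Function.update (fun _ => p) y q)
  have hd : ∀ (p q : L.Term ℕ) (e : ℕ → A.carrier), (d p q).realize e =
      u.realize fun _ => p.realize e := by
    intro p q e
    rw [Term.realize_subst, ← hu A hA (fun _ => p.realize e) (q.realize e)]
    congr 1
    funext i
    by_cases hi : i = y
    · subst hi
      simp
    · simp [hi]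
  have hdvar : ∀ p q : L.Term ℕ, ∀ i, i ∈ (d p q).varFinset ↔
      i ∈ q.varFinset ∨ (i ∈ p.varFinset ∧ ∃ x ∈ u.varFinset, x ≠ y) := by
    intro p q i
    rw [mem_varFinset_subst]
    constructor
    · rintro ⟨j, hj, h⟩
      by_cases hjy : j = y
      · subst hjy
        left
        simpa using h
      · right
        rw [Function.update_of_ne hjy] at h
        exact ⟨h, j, hj, hjy⟩
    · rintro (h | ⟨h, j, hj, hjy⟩)
      · exact ⟨y, hy, by simpa using h⟩
      · exact ⟨j, hj, by rwa [Function.update_of_ne hjy]⟩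
  let σ : L.Term ℕ → ℕ → L.Term ℕ := fun p => Function.update Term.var z p
  have hσ : ∀ (p : L.Term ℕ) {B : Type w} [L.Structure B] (e : ℕ → B),
      (s.subst (σ p)).realize e = s.realize (Function.update e z (p.realize e)) := by
    intro p B _ e
    rw [Term.realize_subst]
    congr 1
    funext i
    by_cases hi : i = z
    · subst hi
      simp [σ]
    · simp [σ, hi]
  have hσvar : ∀ (p : L.Term ℕ) (i : ℕ), i ∈ (s.subst (σ p)).varFinset ↔
      i ∈ p.varFinset ∨ (i ∈ s.varFinset ∧ i ≠ z) := by
    intro p i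
    rw [mem_varFinset_subst]
    constructor
    · rintro ⟨j, hj, h⟩
      by_cases hjz : j = z
      · subst hjz
        left
        simpa [σ] using h
      · right
        simp only [σ, Function.update_of_ne hjz, Term.varFinset, Finset.mem_singleton] at h
        subst h
        exact ⟨hj, hjz⟩
    · rintro (h | ⟨h, hi⟩)
      · exact ⟨z, hz, by simpa [σ] using h⟩
      · exact ⟨i, h, by simp [σ, hi, Term.varFinset]⟩
  have hWs : ∀ p q : L.Term ℕ, W.Satisfies (s.subst (σ p)) (s.subst (σ q)) := by
    intro p q B hB e
    rw [hσ, hσ, hs B hB, hs B hB]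
  by_cases hx : ∃ x ∈ s.varFinset, x ≠ z
  · obtain ⟨x, hxs, hxz⟩ := hx
    -- As `x` already occurs in `s`, replacing `z` by `d x z` keeps the variables of `s`; in `A` the
    -- value of `d x z` depends on `x` only.
    have key : ∀ e : ℕ → A.carrier, s.realize e =
        s.realize (Function.update e z (u.realize fun _ => e x)) := by
      intro e
      have := reg (s.subst (σ (Term.var z))) (s.subst (σ (d (Term.var x) (Term.var z)))) ?_
        (hWs _ _) e
      · rw [hσ, hσ, hd] at this
        simpa using this
      · ext i
        rw [hσvar, hσvar, hdvar]
        simp only [Term.varFinset, Finset.mem_singleton]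
        constructor
        · tauto
        · rintro ((h | ⟨rfl, -⟩) | h)
          · exact Or.inl h
          · exact Or.inr ⟨hxs, hxz⟩
          · exact Or.inr h
    rw [key e, key (Function.update e z a), Function.update_idem, Function.update_of_ne hxz]
  · push Not at hx
    have hreal : ∀ e e' : ℕ → A.carrier, e z = e' z → s.realize e = s.realize e' :=
      fun e e' h => realize_congr s fun i hi => by rw [hx i hi, h]
    have h1 : ∀ e : ℕ → A.carrier, s.realize e =
        s.realize (Function.update e z (u.realize fun _ => e z)) := by
      intro e
      have := reg (s.subst (σ (Term.var z))) (s.subst (σ (d (Term.var z) (Term.var z)))) ?_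
        (hWs _ _) e
      · rw [hσ, hσ, hd] at this
        simpa using this
      · ext i
        rw [hσvar, hσvar, hdvar]
        tauto
    by_cases hxu : ∃ x ∈ u.varFinset, x ≠ y
    -- Here `d z (z+1)` and `d (z+1) z` contain the same two variables, while their values in `A`
    -- depend on `z` and on `z+1` respectively. So `s` is constant.
    · have h2 : ∀ e : ℕ → A.carrier,
          s.realize (Function.update e z (u.realize fun _ => e z)) =
          s.realize (Function.update e z (u.realize fun _ => e (z + 1))) := by
        intro e
        have := reg (s.subst (σ (d (Term.var z) (Term.var (z + 1)))))
          (s.subst (σ (d (Term.var (z + 1)) (Term.var z)))) ?_ (hWs _ _) e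
        · rw [hσ, hσ, hd, hd] at this
          simpa using this
        · ext i
          rw [hσvar, hσvar, hdvar, hdvar]
          have : (∃ x ∈ u.varFinset, x ≠ y) ↔ True := iff_true_intro hxu
          rw [this]
          tauto
      have h3 := h2 (Function.update e (z + 1) a)
      rw [h1 e, h1 (Function.update e z a)]
      refine (hreal _ _ ?_).trans (h3.symm.trans (hreal _ _ ?_)) <;> simp
    -- Now `y` is the only variable of `u`, so `u` is constant in `A`.
    · push Not at hxu
      rw [h1 e, h1 (Function.update e z a)]
      refine hreal _ _ ?_
      simp only [Function.update_self]
      have := hu A hA (fun _ => e z) a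
      rw [← this]
      exact realize_congr u fun i hi => by simp [hxu i hi]

/-- If `s ≈ t` is any identity, then identifying the variables that occur on one side only with a
suitable term gives a regular identity. -/
theorem exists_subst_regular (s t : L.Term ℕ) : ∃ σ : ℕ → L.Term ℕ,
    (∀ i, i ∈ s.varFinset → i ∈ t.varFinset → σ i = Term.var i) ∧
      RegularIdentity (s.subst σ) (t.subst σ) := by
  classical
  -- Replacing all unshared variables by `r` leaves the shared ones on each side, plus those of `r`
  -- on a side that had an unshared one. The choice of `r` below is a shared variable, any variable
  -- if both sides have only unshared ones, or a side without variables.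
  have key : ∀ r : L.Term ℕ, (∀ i, (i ∈ s.varFinset ∧ i ∈ t.varFinset) ∨
        ((∃ j ∈ s.varFinset, j ∉ t.varFinset) ∧ i ∈ r.varFinset) ↔
      (i ∈ s.varFinset ∧ i ∈ t.varFinset) ∨
        ((∃ j ∈ t.varFinset, j ∉ s.varFinset) ∧ i ∈ r.varFinset)) →
      ∃ σ : ℕ → L.Term ℕ,
      (∀ i, i ∈ s.varFinset → i ∈ t.varFinset → σ i = Term.var i) ∧
      RegularIdentity (s.subst σ) (t.subst σ) := by
    intro r hr
    refine ⟨fun i => if i ∈ s.varFinset ∧ i ∈ t.varFinset then Term.var i else r,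
      fun i h h' => by simp [h, h'], ?_⟩
    ext i
    rw [mem_varFinset_subst, mem_varFinset_subst]
    have h1 : ∀ p q : L.Term ℕ, (∃ j ∈ p.varFinset, i ∈ (if j ∈ p.varFinset ∧ j ∈ q.varFinset
        then Term.var j else r).varFinset) ↔ (i ∈ p.varFinset ∧ i ∈ q.varFinset) ∨
        ((∃ j ∈ p.varFinset, j ∉ q.varFinset) ∧ i ∈ r.varFinset) := by
      intro p q
      constructor
      · rintro ⟨j, hj, h⟩
        by_cases hq : j ∈ q.varFinset
        · simp only [hj, hq, and_self, if_true, Term.varFinset, Finset.mem_singleton] at h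
          subst h
          exact Or.inl ⟨hj, hq⟩
        · simp only [hq, and_false, if_false] at h
          exact Or.inr ⟨⟨j, hj, hq⟩, h⟩
      · rintro (⟨hp, hq⟩ | ⟨⟨j, hj, hq⟩, h⟩)
        · exact ⟨i, hp, by simp [hp, hq, Term.varFinset]⟩
        · exact ⟨j, hj, by simpa [hq] using h⟩
    have h2 := h1 t s
    simp only [and_comm (a := _ ∈ t.varFinset) (b := _ ∈ s.varFinset)] at h2
    rw [h1 s t, h2]
    exact hr i
  by_cases hst : ∃ x ∈ s.varFinset, x ∈ t.varFinset
  · obtain ⟨x, hxs, hxt⟩ := hst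
    refine key (Term.var x) fun i => ?_
    simp only [Term.varFinset, Finset.mem_singleton]
    constructor <;>
    · rintro (h | ⟨-, rfl⟩)
      · exact Or.inl h
      · exact Or.inl ⟨hxs, hxt⟩
  · push Not at hst
    by_cases hs : s.varFinset.Nonempty
    · by_cases ht : t.varFinset.Nonempty
      · obtain ⟨a, ha⟩ := hs
        obtain ⟨b, hb⟩ := ht
        have hb' : b ∉ s.varFinset := fun h => hst b h hb
        have h1 : ∃ j ∈ s.varFinset, j ∉ t.varFinset := ⟨a, ha, hst a ha⟩
        have h2 : ∃ j ∈ t.varFinset, j ∉ s.varFinset := ⟨b, hb, hb'⟩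
        exact key (Term.var 0) fun i => by simp only [h1, h2]
      · rw [Finset.not_nonempty_iff_eq_empty] at ht
        exact key t fun i => by simp [ht]
    · rw [Finset.not_nonempty_iff_eq_empty] at hs
      exact key s fun i => by simp [hs]

/-- An irregular variety between `W` and `R(W)` satisfies all identities of `W`. -/
theorem le_of_isIrregular [L.IsAlgebraic] {U W : Variety.{u, v, max u w} L}
    (hU : U ≤ W.regularization) (hirr : U.IsIrregular) : U ≤ W := by
  refine le_of_satisfies fun s t hst A hA e => ?_
  obtain ⟨σ, hσ, hreg⟩ := exists_subst_regular s t
  have indep : ∀ p q : L.Term ℕ, W.Satisfies p q →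
      (∀ i, i ∈ p.varFinset → i ∈ q.varFinset → σ i = Term.var i) →
      p.realize e = p.realize fun i => (σ i).realize e := by
    intro p q hpq h
    -- The valuation changes only on variables of `p`, since `σ` may move variables that occur in
    -- `q` alone.
    refine (realize_eq_of_update p {i | i ∈ q.varFinset} (fun z hz => ?_)
      (e' := fun i => if i ∈ p.varFinset then (σ i).realize e else e i) fun i hi => ?_).trans
        (realize_congr p fun i hi => by simp [hi])
    · refine realize_update_of_irregular hU hirr p z (fun B hB e a => ?_) A hA
      rw [hpq B hB, hpq B hB]
      refine realize_congr q fun i hi => Function.update_of_ne ?_ _ _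
      rintro rfl
      exact hz hi
    · by_cases hp : i ∈ p.varFinset
      · simp [hp, h i hp hi]
      · simp [hp]
  rw [indep s t hst hσ, indep t s (fun B hB e => (hst B hB e).symm) fun i h h' => hσ i h' h,
    ← Term.realize_subst, ← Term.realize_subst]
  have hWσ : W.Satisfies (s.subst σ) (t.subst σ) := by
    intro B hB d
    rw [Term.realize_subst, Term.realize_subst]
    exact hst B hB _
  exact hU A hA _ _ ⟨hreg, hWσ⟩ e

/-! ### Covering, injectivity and joins -/

theorem regularization_le_of_isRegular [L.IsAlgebraic] {U W : Variety.{u, v, max u w} L}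
    (hW : W ≤ U) (hreg : U.IsRegular) : W.regularization ≤ U :=
  le_of_satisfies fun s t hst => (W.regularization_satisfies_iff s t).2
    ⟨hreg s t hst, fun A hA => hst A (hW A hA)⟩

theorem lt_regularization {W : Variety.{u, v, w} L} (hW : W.IsIrregular) :
    W < W.regularization :=
  lt_of_le_of_ne W.le_regularization fun h => hW (h ▸ W.regularization_isRegular)

theorem subIncl_covBy_subReg [L.IsAlgebraic] {V : Variety.{u, v, max u w} L} (hV : V.IsIrregular)
    (W : Set.Iic V) : V.subIncl W ⋖ V.subReg W := by
  refine ⟨lt_regularization (hV.anti W.2), fun U hWU hUR => ?_⟩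
  by_cases hU : U.1.IsRegular
  · exact not_le_of_gt hUR (regularization_le_of_isRegular (W := W.1) hWU.le hU)
  · exact not_le_of_gt hWU (le_of_isIrregular (W := W.1) hUR.le hU)

/-- Recovers `W` from its regularization, which yields injectivity. -/
theorem regularization_inf_of_isIrregular [L.IsAlgebraic] {V W : Variety.{u, v, max u w} L}
    (hV : V.IsIrregular) (hW : W ≤ V) : W.regularization ⊓ V = W :=
  le_antisymm (le_of_isIrregular inf_le_left (hV.anti inf_le_right))
    (le_inf W.le_regularization hW)

theorem regularization_sup [L.IsAlgebraic] (V W : Variety.{u, v, max u w} L) :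
    (V ⊔ W).regularization = V.regularization ⊔ W.regularization := by
  refine le_antisymm (le_of_satisfies fun s t hst => ?_)
    (sup_le (regularization_mono le_sup_left) (regularization_mono le_sup_right))
  have h1 := (V.regularization_satisfies_iff s t).1
    fun A hA => hst A ((le_sup_left : V.regularization ≤ _) A hA)
  have h2 := (W.regularization_satisfies_iff s t).1
    fun A hA => hst A ((le_sup_right : W.regularization ≤ _) A hA)
  refine (regularization_satisfies_iff _ s t).2 ⟨h1.1, fun A hA => ?_⟩
  -- The single identity `s ≈ t` defines a variety containing both `V` and `W`, hence their join.
  have hle : V ⊔ W ≤ ofIdentities fun p q => p = s ∧ q = t :=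
    sup_le (fun B hB p q h => by rw [h.1, h.2]; exact h1.2 B hB)
      (fun B hB p q h => by rw [h.1, h.2]; exact h2.2 B hB)
  exact hle A hA s t ⟨rfl, rfl⟩

end Variety

end UniversalAlgebra

/-! ### Płonka fibres and meets -/

namespace UniversalAlgebra

open FirstOrder FirstOrder.Language

namespace Variety

variable {L : FirstOrder.Language.{u, v}}

/-- The binary operation on an algebra that is given by a term `f` in the variables `0` and `1`. -/
def binOp (f : L.Term ℕ) {M : Type*} [L.Structure M] (a b : M) : M :=
  f.realize fun i => if i = 0 then a else b

/-- The term `f(p, q)`. -/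
def binTerm (f p q : L.Term ℕ) : L.Term ℕ :=
  f.subst fun i => if i = 0 then p else q

theorem realize_binTerm (f p q : L.Term ℕ) {M : Type*} [L.Structure M] (e : ℕ → M) :
    (binTerm f p q).realize e = binOp f (p.realize e) (q.realize e) := by
  rw [binTerm, Term.realize_subst, binOp]
  congr 1
  funext i
  split <;> rfl

theorem mem_varFinset_binTerm {f : L.Term ℕ} (hf : f.varFinset = {0, 1}) (p q : L.Term ℕ) (i : ℕ) :
    i ∈ (binTerm f p q).varFinset ↔ i ∈ p.varFinset ∨ i ∈ q.varFinset := by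
  rw [binTerm, mem_varFinset_subst, hf]
  simp

theorem binOp_eq {V : Variety.{u, v, w} L} {f : L.Term ℕ} (hV : V.Satisfies f (Term.var 0))
    {B : Alg.{u, v, w} L} (hB : V.Mem B) (a b : B.carrier) : binOp f a b = a := by
  rw [binOp, hV B hB]
  simp

theorem realize_eq_of_regular {V : Variety.{u, v, w} L} {A : Alg.{u, v, w} L}
    (hA : V.regularization.Mem A) {p q : L.Term ℕ}
    (hvar : ∀ i, i ∈ p.varFinset ↔ i ∈ q.varFinset) (hpq : V.Satisfies p q) (e : ℕ → A.carrier) :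
    p.realize e = q.realize e :=
  hA p q ⟨Finset.ext hvar, hpq⟩ e

/-- A term in the variables of `S` and `z` which takes the value of `z` at all points at which that
value absorbs the values of the variables in `S`. -/
theorem exists_absorbing_term {f : L.Term ℕ} (hf : f.varFinset = {0, 1}) (S : Finset ℕ) (z : ℕ) :
    ∃ R : L.Term ℕ, R.varFinset = insert z S ∧ ∀ (M : Type w) [L.Structure M] (e : ℕ → M),
      (∀ i ∈ S, binOp f (e z) (e i) = e z) → R.realize e = e z := by
  induction S using Finset.induction_on with
  | empty => exact ⟨Term.var z, by simp [Term.varFinset], fun _ _ _ _ => rfl⟩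
  | insert i S hi ih =>
    obtain ⟨R, hR, h⟩ := ih
    refine ⟨binTerm f R (Term.var i), ?_, fun M _ e he => ?_⟩
    · ext j
      rw [mem_varFinset_binTerm hf, hR]
      simp only [Term.varFinset, Finset.mem_insert, Finset.mem_singleton]
      tauto
    · rw [realize_binTerm, h M e fun j hj => he j (Finset.mem_insert_of_mem hj)]
      exact he i (Finset.mem_insert_self _ _)

section StronglyIrregular

variable {V : Variety.{u, v, w} L} {f : L.Term ℕ} {A : Alg.{u, v, w} L}

theorem binOp_self (hf : f.varFinset = {0, 1}) (hV : V.Satisfies f (Term.var 0))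
    (hA : V.regularization.Mem A)
    (a : A.carrier) : binOp f a a = a := by
  have := realize_eq_of_regular hA (p := binTerm f (Term.var 0) (Term.var 0)) (q := Term.var 0)
    (fun i => by rw [mem_varFinset_binTerm hf, or_self])
    (fun B hB e => by rw [realize_binTerm, binOp_eq hV hB]) fun _ => a
  rwa [realize_binTerm] at this

theorem binOp_binOp_right (hf : f.varFinset = {0, 1}) (hV : V.Satisfies f (Term.var 0))
    (hA : V.regularization.Mem A)
    (a b : A.carrier) : binOp f (binOp f a b) b = binOp f a b := by
  have := realize_eq_of_regular hA
    (p := binTerm f (binTerm f (Term.var 0) (Term.var 1)) (Term.var 1))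
    (q := binTerm f (Term.var 0) (Term.var 1))
    (fun i => by simp only [mem_varFinset_binTerm hf]; tauto)
    (fun B hB e => by simp only [realize_binTerm, binOp_eq hV hB]) fun i => if i = 0 then a else b
  simpa [realize_binTerm] using this

theorem binOp_funMap (hf : f.varFinset = {0, 1}) (hV : V.Satisfies f (Term.var 0))
    (hA : V.regularization.Mem A)
    {n : ℕ} (g : L.Functions n) (x : Fin n → A.carrier) (c : A.carrier) :
    binOp f (Structure.funMap g fun k => binOp f (x k) c) c = binOp f (Structure.funMap g x) c := by
  have := realize_eq_of_regular hA
    (p := binTerm f (Term.func g fun k => binTerm f (Term.var k) (Term.var n)) (Term.var n))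
    (q := binTerm f (Term.func g fun k => Term.var k) (Term.var n))
    (fun i => by
      simp only [mem_varFinset_binTerm hf, mem_varFinset_func]
      constructor
      · rintro (⟨k, h | h⟩ | h)
        · exact Or.inl ⟨k, h⟩
        · exact Or.inr h
        · exact Or.inr h
      · rintro (⟨k, h⟩ | h)
        · exact Or.inl ⟨k, Or.inl h⟩
        · exact Or.inr h)
    (fun B hB e => by simp only [realize_binTerm, binOp_eq hV hB, Term.realize_func])
    fun i => if h : i < n then x ⟨i, h⟩ else c
  simpa [realize_binTerm] using this

/-- With `R` absorbing the variables of `p` into a fresh `z`, the identity `f(R, p) ≈ R` is regular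
and holds in `V`; at `z = c` the term `R` takes the value `c`. -/
theorem binOp_realize (hf : f.varFinset = {0, 1}) (hV : V.Satisfies f (Term.var 0))
    (hA : V.regularization.Mem A)
    (p : L.Term ℕ) (e : ℕ → A.carrier) (c : A.carrier)
    (h : ∀ i ∈ p.varFinset, binOp f c (e i) = c) : binOp f c (p.realize e) = c := by
  obtain ⟨z, hz⟩ := Infinite.exists_notMem_finset p.varFinset
  have hne : ∀ i ∈ p.varFinset, i ≠ z := fun i hi hiz => hz (hiz ▸ hi)
  obtain ⟨R, hR, hRe⟩ := exists_absorbing_term.{u, v, w} hf p.varFinset z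
  have := realize_eq_of_regular hA (p := binTerm f R p) (q := R)
    (fun i => by rw [mem_varFinset_binTerm hf, hR, Finset.mem_insert]; tauto)
    (fun B hB e => by rw [realize_binTerm, binOp_eq hV hB]) (Function.update e z c)
  rw [realize_binTerm, hRe _ _ fun i hi => by simp [hne i hi, h i hi], Function.update_self] at this
  rwa [realize_congr p fun i hi => Function.update_of_ne (hne i hi) c e] at this

/-- Multiplying both sides by a term `R` in all the variables makes `p ≈ q` regular, and `R` takes
the value `c` at the point considered. -/
theorem binOp_realize_congr (hf : f.varFinset = {0, 1}) {W : Variety.{u, v, w} L}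
    (hAW : W.regularization.Mem A) {p q : L.Term ℕ} (hpq : W.Satisfies p q) (e : ℕ → A.carrier) (c : A.carrier)
    (h : ∀ i, binOp f c (e i) = c) : binOp f (p.realize e) c = binOp f (q.realize e) c := by
  obtain ⟨z, hz⟩ := Infinite.exists_notMem_finset (p.varFinset ∪ q.varFinset)
  have hne : ∀ i ∈ p.varFinset ∪ q.varFinset, i ≠ z := fun i hi hiz => hz (hiz ▸ hi)
  obtain ⟨R, hR, hRe⟩ := exists_absorbing_term.{u, v, w} hf (p.varFinset ∪ q.varFinset) z
  have := realize_eq_of_regular hAW (p := binTerm f p R) (q := binTerm f q R)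
    (fun i => by
      simp only [mem_varFinset_binTerm hf, hR, Finset.mem_insert, Finset.mem_union]
      tauto)
    (fun B hB e => by rw [realize_binTerm, realize_binTerm, hpq B hB]) (Function.update e z c)
  rw [realize_binTerm, realize_binTerm, hRe _ _ fun i hi => by simp [hne i hi, h i],
    Function.update_self] at this
  rwa [realize_congr p fun i hi =>
      Function.update_of_ne (hne i (Finset.mem_union_left _ hi)) c e,
    realize_congr q fun i hi =>
      Function.update_of_ne (hne i (Finset.mem_union_right _ hi)) c e] at this

theorem binOp_funMap_mem (hf : f.varFinset = {0, 1}) (hV : V.Satisfies f (Term.var 0))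
    (hA : V.regularization.Mem A)
    {n : ℕ} (g : L.Functions n) (x : Fin n → A.carrier) (c : A.carrier)
    (h : ∀ k, binOp f c (x k) = c) :
    binOp f c (binOp f (Structure.funMap g x) c) = c := by
  have := binOp_realize hf hV hA (binTerm f (Term.func g fun k => Term.var k) (Term.var n))
    (fun i => if h : i < n then x ⟨i, h⟩ else c) c fun i _ => by
      by_cases hi : i < n
      · simp [hi, h]
      · simp [hi, binOp_self hf hV hA]
  simpa [realize_binTerm] using this

/-- The fibre of `c` in the Płonka decomposition of a member of `R(V)`. -/
def fibre (hf : f.varFinset = {0, 1}) (hV : V.Satisfies f (Term.var 0))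
    (hA : V.regularization.Mem A) (c : A.carrier) : Alg.{u, v, w} L :=
  letI : L.Structure {a : A.carrier // binOp f c a = c ∧ binOp f a c = a} :=
    -- The factor `c` is there for constants, which need not lie in the fibre; at positive arity it
    -- changes nothing.
    { funMap := fun g x => ⟨binOp f (Structure.funMap g fun k => (x k).1) c,
        binOp_funMap_mem hf hV hA g _ c fun k => (x k).2.1, binOp_binOp_right hf hV hA _ _⟩
      RelMap := fun _ _ => True }
  haveI : Nonempty {a : A.carrier // binOp f c a = c ∧ binOp f a c = a} :=
    ⟨c, binOp_self hf hV hA c, binOp_self hf hV hA c⟩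
  { carrier := {a : A.carrier // binOp f c a = c ∧ binOp f a c = a} }

theorem realize_fibre (hf : f.varFinset = {0, 1}) (hV : V.Satisfies f (Term.var 0))
    (hA : V.regularization.Mem A)
    (c : A.carrier) (t : L.Term ℕ) (e : ℕ → (fibre hf hV hA c).carrier) :
    (t.realize e).1 = binOp f (t.realize fun i => (e i).1) c := by
  induction t with
  | var n => exact (e n).2.2.symm
  | func g ts ih =>
    refine Eq.trans ?_ (binOp_funMap hf hV hA g _ c)
    exact congrArg (fun x => binOp f (Structure.funMap g x) c) (funext ih)

end StronglyIrregular

theorem fibre_mem [L.IsAlgebraic] {V W : Variety.{u, v, max u w} L} {f : L.Term ℕ}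
    (hf : f.varFinset = {0, 1}) (hV : V.Satisfies f (Term.var 0)) {A : Alg.{u, v, max u w} L}
    (hA : V.regularization.Mem A) (hAW : W.regularization.Mem A) (c : A.carrier) :
    W.Mem (fibre hf hV hA c) := by
  refine W.mem_of_satisfies _ fun s t hst e => Subtype.ext ?_
  refine (realize_fibre hf hV hA c s e).trans (Eq.trans ?_ (realize_fibre hf hV hA c t e).symm)
  exact binOp_realize_congr hf hAW hst _ c fun i => (e i).2.1

/-- At a point `e` put `c = s(e)`. Each `e i` with `i` in `s` moves into the fibre of `c` as `e i ·
c`, without changing the values of `s` and `t`; the fibre lies in `W₁ ⊓ W₂`. -/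
theorem regularization_inf_le [L.IsAlgebraic] {V W₁ W₂ : Variety.{u, v, max u w} L}
    (hV : V.IsStronglyIrregular) (h₁ : W₁ ≤ V) :
    W₁.regularization ⊓ W₂.regularization ≤ (W₁ ⊓ W₂).regularization := by
  obtain ⟨f, hf, hfV⟩ := hV
  rintro A ⟨hA₁, hA₂⟩ s t ⟨hreg, hst⟩ e
  have hA : V.regularization.Mem A := regularization_mono h₁ A hA₁
  set c := s.realize e with hc
  have hF := hst (fibre hf hfV hA c) ⟨fibre_mem hf hfV hA hA₁ c, fibre_mem hf hfV hA hA₂ c⟩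
  have hmem : ∀ i ∈ s.varFinset, binOp f c (binOp f (e i) c) = c := by
    intro i hi
    -- `s·(xᵢ·s) ≈ s` is regular because `xᵢ` occurs in `s`.
    have := realize_eq_of_regular hA (p := binTerm f s (binTerm f (Term.var i) s)) (q := s)
      (fun j => by
        simp only [mem_varFinset_binTerm hf, Term.varFinset, Finset.mem_singleton]
        constructor
        · rintro (h | rfl | h) <;> assumption
        · exact Or.inl)
      (fun B hB e => by rw [realize_binTerm, binOp_eq hfV hB]) e
    simpa [realize_binTerm] using this
  let d : ℕ → (fibre hf hfV hA c).carrier := fun i =>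
    if hi : i ∈ s.varFinset then
      ⟨binOp f (e i) c, hmem i hi, binOp_binOp_right hf hfV hA _ _⟩
    else ⟨c, binOp_self hf hfV hA c, binOp_self hf hfV hA c⟩
  -- The identity `p(…, xᵢ·s, …)·s ≈ p` holds in `V`, and is regular since `p` and `s` have the same
  -- variables. The default `c` in `d` is therefore never used.
  have key : ∀ p : L.Term ℕ, p.varFinset = s.varFinset →
      (p.realize d).1 = p.realize e := by
    intro p hp
    refine (realize_fibre hf hfV hA c p d).trans ?_
    have := realize_eq_of_regular hA
      (p := binTerm f (p.subst fun i => binTerm f (Term.var i) s) s) (q := p)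
      (fun j => by
        rw [mem_varFinset_binTerm hf, mem_varFinset_subst, hp]
        constructor
        · rintro (⟨i, hi, h⟩ | h)
          · rw [mem_varFinset_binTerm hf] at h
            rcases h with h | h
            · simp only [Term.varFinset, Finset.mem_singleton] at h
              exact h ▸ hi
            · exact h
          · exact h
        · exact Or.inr)
      (fun B hB e => by
        simp only [realize_binTerm, binOp_eq hfV hB, Term.realize_subst, Term.realize_var]) e
    rw [realize_binTerm, Term.realize_subst] at this
    rw [← this]
    congr 1
    refine realize_congr p fun i hi => ?_
    rw [hp] at hi
    rw [realize_binTerm, Term.realize_var]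
    exact congrArg Subtype.val (dif_pos hi)
  rw [← key t hreg.symm, ← hF d]
  exact (key s rfl).symm

theorem IsStronglyIrregular.isIrregular {V : Variety.{u, v, w} L} (hV : V.IsStronglyIrregular) :
    V.IsIrregular := by
  obtain ⟨f, hf, hfV⟩ := hV
  intro h
  have h1 : f.varFinset = (Term.var 0 : L.Term ℕ).varFinset := h _ _ hfV
  have h2 : 1 ∈ (Term.var 0 : L.Term ℕ).varFinset := by
    rw [← h1, hf]
    simp
  simp [Term.varFinset] at h2

theorem subReg_injective [L.IsAlgebraic] {V : Variety.{u, v, max u w} L} (hV : V.IsIrregular) :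
    Function.Injective V.subReg := by
  intro W₁ W₂ h
  have h' : W₁.1.regularization = W₂.1.regularization := congrArg Subtype.val h
  refine Subtype.ext ?_
  rw [← regularization_inf_of_isIrregular hV W₁.2, h', regularization_inf_of_isIrregular hV W₂.2]

/-- The map `W ↦ R(W)`, as a lattice homomorphism. -/
def subRegHom [L.IsAlgebraic] (V : Variety.{u, v, max u w} L) (hV : V.IsStronglyIrregular) :
    LatticeHom (Set.Iic V) (Set.Iic V.regularization) where
  toFun := V.subReg
  map_sup' W₁ W₂ := Subtype.ext (regularization_sup W₁.1 W₂.1)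
  map_inf' W₁ _ := Subtype.ext (le_antisymm
    (le_inf (regularization_mono inf_le_left) (regularization_mono inf_le_right))
    (regularization_inf_le hV W₁.2))

end Variety

end UniversalAlgebra

theorem mainTheorem10 (L : FirstOrder.Language.{u, v}) [L.IsAlgebraic]
    (V : UniversalAlgebra.Variety.{u, v, max u w} L) :
    (V.IsIrregular → ∀ W : Set.Iic V, V.subIncl W ⋖ V.subReg W) ∧
    (V.IsStronglyIrregular →
      ∃ h : LatticeHom (Set.Iic V) (Set.Iic V.regularization),
        Function.Injective h ∧ ∀ W : Set.Iic V, h W = V.subReg W) :=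
  ⟨fun hV W => UniversalAlgebra.Variety.subIncl_covBy_subReg hV W,
    fun hV => ⟨V.subRegHom hV, UniversalAlgebra.Variety.subReg_injective hV.isIrregular,
      fun _ => rfl⟩⟩
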